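/- Let $f(x)=\int_0^x\cos\left(\frac{\pi}{2}t^2\right)dt$, let $x_0>0$ be arbitrary, let $x_n=f(x_{n-1})$ for $n\ge 1$, and put $\kappa=\sqrt{5/8}/\pi$. Then there is a real constant $C=C(x_0)$ (depending only on $x_0$) such that, as $n\to\infty$, \begin{align*} \frac{x_n}{\sqrt{\kappa}} ={}& \frac{2}{n^{1/4}}-\frac{55}{216}\frac{\ln(n)}{n^{5/4}}+\frac{C}{2}\frac{1}{n^{5/4}}+\frac{15125}{186624}\frac{\ln(n)^{2}}{n^{9/4}}-\left(\frac{275}{864}C+\frac{3025}{23328}\right)\frac{\ln(n)}{n^{9/4}}\\ &+\left(\frac{5}{16}C^{2}+\frac{55}{216}C+\frac{25745}{303264}\right)\frac{1}{n^{9/4}}-\frac{831875}{26873856}\frac{\ln(n)^{3}}{n^{13/4}}+\left(\frac{15125}{82944}C+\frac{1164625}{10077696}\right)\frac{\ln(n)^{2}}{n^{13/4}}\\ &-\left(\frac{275}{768}C^{2}+\frac{21175}{46656}C+\frac{21395275}{131010048}\right)\frac{\ln(n)}{n^{13/4}}+\left(\frac{15}{64}C^{3}+\frac{385}{864}C^{2}+\frac{389005}{1213056}C+\frac{587905525}{7795097856}\right)\frac{1}{n^{13/4}}\\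 &+\frac{594790625}{46438023168}\frac{\ln(n)^{4}}{n^{17/4}}-\left(\frac{10814375}{107495424}C+\frac{2077191875}{26121388032}\right)\frac{\ln(n)^{3}}{n^{17/4}}\\ &+\left(\frac{196625}{663552}C^{2}+\frac{37767125}{80621568}C+\frac{187686125}{967458816}\right)\frac{\ln(n)^{2}}{n^{17/4}}\\ &-\left(\frac{3575}{9216}C^{3}+\frac{686675}{746496}C^{2}+\frac{3412475}{4478976}C+\frac{700416600125}{3367482273792}\right)\frac{\ln(n)}{n^{17/4}}\\ &+\left(\frac{195}{1024}C^{4}+\frac{12485}{20736}C^{3}+\frac{62045}{82944}C^{2}+\frac{12734847275}{31180391424}C+\frac{73718758987739}{919322660745216}\right)\frac{1}{n^{17/4}}+O\left(\frac{\ln(n)^5}{n^{21/4}}\right). \end{align*} Moreover, with the same constant $C$ and with $\tau=4$, $\lambda=10/\pi^2$, $b_1=55/108$, \[ x_n=\left(\frac{\lambda}{n}\right)^{1/\tau}\left\{1+\sum_{m=1}^{4}P_m\left(-\frac1\tau\left[b_1\ln(n)-C\right]\right)\frac{1}{n^m}\right\}+O\left(\frac{\ln(n)^5}{n^{21/4}}\right),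 \] where \begin{align*} P_1(X)&=X,\qquad P_2(X)=\frac52X^2+\frac{55}{108}X+\frac{25745}{606528},\\ P_3(X)&=\frac{15}{2}X^3+\frac{385}{108}X^2+\frac{389005}{606528}X+\frac{587905525}{15590195712},\\ P_4(X)&=\frac{195}{8}X^4+\frac{12485}{648}X^3+\frac{62045}{10368}X^2+\frac{12734847275}{15590195712}X+\frac{73718758987739}{1838645321490432}. \end{align*} -/

import Mathlib

open Filter Asymptotics

noncomputable section

/-- The Fresnel cosine integral `f(x) = ∫₀ˣ cos(π t² / 2) dt`. -/
def fresnelCos (x : ℝ) : ℝ :=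
  ∫ t in (0 : ℝ)..x, Real.cos (Real.pi / 2 * t ^ 2)

/-- The constant `κ = √(5/8) / π`. -/
def fresnelKappa : ℝ := Real.sqrt (5 / 8) / Real.pi

/-- The polynomials `P₁, …, P₄` attached to the Fresnel cosine (with `P₀ = 1`; the value for
`m ≥ 5` is never used). -/
def fresnelP : ℕ → ℝ → ℝ
  | 0, _ => 1
  | 1, X => X
  | 2, X => 5 / 2 * X ^ 2 + 55 / 108 * X + 25745 / 606528
  | 3, X => 15 / 2 * X ^ 3 + 385 / 108 * X ^ 2 + 389005 / 606528 * X
      + 587905525 / 15590195712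
  | 4, X => 195 / 8 * X ^ 4 + 12485 / 648 * X ^ 3 + 62045 / 10368 * X ^ 2
      + 12734847275 / 15590195712 * X + 73718758987739 / 1838645321490432
  | _, _ => 0

/-- `(λ/n)^{1/τ} {1 + ∑_{m=1}^{4} P_m(-(1/τ)[b₁ ln n - C]) n^{-m}}` with `τ = 4`,
`λ = 10/π²`, `b₁ = 55/108`. -/
def fresnelFormulaB (C : ℝ) (n : ℕ) : ℝ :=
  (10 / Real.pi ^ 2 / (n : ℝ)) ^ (1 / 4 : ℝ) *
    (1 + ∑ m ∈ Finset.Icc 1 4,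
      fresnelP m (-(1 / 4) * (55 / 108 * Real.log n - C)) * (1 / (n : ℝ) ^ m))

/-- The explicit expansion of `x_n / √κ` in powers `n^{-1/4}, …, n^{-17/4}` and `ln n`. -/
def fresnelExpansion (C : ℝ) (n : ℕ) : ℝ :=
  2 / (n : ℝ) ^ (1 / 4 : ℝ)
  - 55 / 216 * (Real.log n / (n : ℝ) ^ (5 / 4 : ℝ))
  + C / 2 * (1 / (n : ℝ) ^ (5 / 4 : ℝ))
  + 15125 / 186624 * (Real.log n ^ 2 / (n : ℝ) ^ (9 / 4 : ℝ))
  - (275 / 864 * C + 3025 / 23328) * (Real.log n / (n : ℝ) ^ (9 / 4 : ℝ))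
  + (5 / 16 * C ^ 2 + 55 / 216 * C + 25745 / 303264) * (1 / (n : ℝ) ^ (9 / 4 : ℝ))
  - 831875 / 26873856 * (Real.log n ^ 3 / (n : ℝ) ^ (13 / 4 : ℝ))
  + (15125 / 82944 * C + 1164625 / 10077696) * (Real.log n ^ 2 / (n : ℝ) ^ (13 / 4 : ℝ))
  - (275 / 768 * C ^ 2 + 21175 / 46656 * C + 21395275 / 131010048)
      * (Real.log n / (n : ℝ) ^ (13 / 4 : ℝ))
  + (15 / 64 * C ^ 3 + 385 / 864 * C ^ 2 + 389005 / 1213056 * C + 587905525 / 7795097856)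
      * (1 / (n : ℝ) ^ (13 / 4 : ℝ))
  + 594790625 / 46438023168 * (Real.log n ^ 4 / (n : ℝ) ^ (17 / 4 : ℝ))
  - (10814375 / 107495424 * C + 2077191875 / 26121388032)
      * (Real.log n ^ 3 / (n : ℝ) ^ (17 / 4 : ℝ))
  + (196625 / 663552 * C ^ 2 + 37767125 / 80621568 * C + 187686125 / 967458816)
      * (Real.log n ^ 2 / (n : ℝ) ^ (17 / 4 : ℝ))
  - (3575 / 9216 * C ^ 3 + 686675 / 746496 * C ^ 2 + 3412475 / 4478976 * C
      + 700416600125 / 3367482273792) * (Real.log n / (n : ℝ) ^ (17 / 4 : ℝ))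
  + (195 / 1024 * C ^ 4 + 12485 / 20736 * C ^ 3 + 62045 / 82944 * C ^ 2
      + 12734847275 / 31180391424 * C + 73718758987739 / 919322660745216)
      * (1 / (n : ℝ) ^ (17 / 4 : ℝ))

end

/-! The map `fresnelCos` is linearised by an approximate Abel function. In the variable z =
`fresnelVar` x one has f(x) = x (1 - z/4 + ...), so z is sent to z (1 - z + ...) and 1/z grows by
about 1 per step. Adding a logarithm and a cubic polynomial to 1/z gives `fresnelAbel`, which grows
by 1 + O(z^5) per step (`fresnelAbel_fresnelCos_sub`).

Positive orbits decrease to 0, and a Cesàro argument gives z_n = O(1/n). The errors O(n^-5) are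
therefore summable, and the Abel function at z_n is n - C + O(n^-4); this defines C
(`exists_fresnelAbel_iterate_isBigO`).

It remains to invert. The proposed formula is substituted into the Abel function and gives n - C up
to O(ln(n)^5 / n^4) (`fresnelAbel_fresnelFactor_isBigO`). Near 0 the Abel function controls
differences of 1/z (`half_mul_abs_sub_le_fresnelAbel`), so orbit and formula are close, first in 1/z
and then in x.

All coefficient checks are done by `HasExpansion`, a calculus of fourth-order expansions with
bounded coefficient functions, which lets ln(n) enter the coefficients. -/

/-- `f = c₀ + c₁ e + c₂ e² + c₃ e³ + c₄ e⁴ + O(e⁵)` along `l`, with coefficient functions `cᵢ`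
that stay bounded along `l`. -/
structure HasExpansion {α : Type*} (l : Filter α) (e f c0 c1 c2 c3 c4 : α → ℝ) : Prop where
  b0 : c0 =O[l] fun _ => (1 : ℝ)
  b1 : c1 =O[l] fun _ => (1 : ℝ)
  b2 : c2 =O[l] fun _ => (1 : ℝ)
  b3 : c3 =O[l] fun _ => (1 : ℝ)
  b4 : c4 =O[l] fun _ => (1 : ℝ)
  rem : (fun x => f x - (c0 x + c1 x * e x + c2 x * e x ^ 2 + c3 x * e x ^ 3 + c4 x * e x ^ 4))
    =O[l] fun x => e x ^ 5

/-! ### Arithmetic of truncated expansions -/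

section Bounded

variable {α : Type*} {l : Filter α} {f g : α → ℝ}

theorem isBigO_one_mul (hf : f =O[l] fun _ => (1 : ℝ)) (hg : g =O[l] fun _ => (1 : ℝ)) :
    (fun x => f x * g x) =O[l] fun _ => (1 : ℝ) := by
  simpa using hf.mul hg

theorem isBigO_one_pow (hf : f =O[l] fun _ => (1 : ℝ)) (n : ℕ) :
    (fun x => f x ^ n) =O[l] fun _ => (1 : ℝ) := by
  simpa using hf.pow n

theorem isBigO_one_const (r : ℝ) : (fun _ : α => r) =O[l] fun _ => (1 : ℝ) :=
  isBigO_const_const r one_ne_zero l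

theorem isBigO_mul_one (hf : f =O[l] fun _ => (1 : ℝ)) : (fun x => g x * f x) =O[l] g := by
  simpa using (isBigO_refl g l).mul hf

end Bounded

namespace HasExpansion

variable {α : Type*} {l : Filter α} {e f g a0 a1 a2 a3 a4 b0 b1 b2 b3 b4 : α → ℝ}

theorem congr' {c0 c1 c2 c3 c4 : α → ℝ} (h : HasExpansion l e f a0 a1 a2 a3 a4)
    (hf : ∀ᶠ x in l, f x = g x)
    (h0 : ∀ x, a0 x = c0 x) (h1 : ∀ x, a1 x = c1 x) (h2 : ∀ x, a2 x = c2 x)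
    (h3 : ∀ x, a3 x = c3 x) (h4 : ∀ x, a4 x = c4 x) : HasExpansion l e g c0 c1 c2 c3 c4 := by
  obtain rfl : a0 = c0 := funext h0
  obtain rfl : a1 = c1 := funext h1
  obtain rfl : a2 = c2 := funext h2
  obtain rfl : a3 = c3 := funext h3
  obtain rfl : a4 = c4 := funext h4
  refine ⟨h.b0, h.b1, h.b2, h.b3, h.b4, h.rem.congr' ?_ EventuallyEq.rfl⟩
  filter_upwards [hf] with x hx
  rw [hx]

theorem isBigO_poly (he : e =O[l] fun _ => (1 : ℝ)) (h : HasExpansion l e f a0 a1 a2 a3 a4) :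
    (fun x => a0 x + a1 x * e x + a2 x * e x ^ 2 + a3 x * e x ^ 3 + a4 x * e x ^ 4)
      =O[l] fun _ => (1 : ℝ) :=
  ((((h.b0.add (isBigO_one_mul h.b1 he)).add (isBigO_one_mul h.b2 (isBigO_one_pow he 2))).add
    (isBigO_one_mul h.b3 (isBigO_one_pow he 3))).add (isBigO_one_mul h.b4 (isBigO_one_pow he 4)))

theorem isBigO_one (he : e =O[l] fun _ => (1 : ℝ)) (h : HasExpansion l e f a0 a1 a2 a3 a4) :
    f =O[l] fun _ => (1 : ℝ) := by
  have := (h.rem.trans (isBigO_one_pow he 5)).add (h.isBigO_poly he)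
  simpa using this

theorem const (r : ℝ) : HasExpansion l e (fun _ => r) (fun _ => r) (fun _ => 0) (fun _ => 0)
    (fun _ => 0) (fun _ => 0) :=
  ⟨isBigO_one_const _, isBigO_one_const _, isBigO_one_const _, isBigO_one_const _,
    isBigO_one_const _, by simpa using isBigO_zero _ _⟩

theorem add (h : HasExpansion l e f a0 a1 a2 a3 a4) (k : HasExpansion l e g b0 b1 b2 b3 b4) :
    HasExpansion l e (fun x => f x + g x) (fun x => a0 x + b0 x) (fun x => a1 x + b1 x)
      (fun x => a2 x + b2 x) (fun x => a3 x + b3 x) (fun x => a4 x + b4 x) :=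
  ⟨h.b0.add k.b0, h.b1.add k.b1, h.b2.add k.b2, h.b3.add k.b3, h.b4.add k.b4,
    (h.rem.add k.rem).congr_left fun x => by ring⟩

theorem const_mul (r : ℝ) (h : HasExpansion l e f a0 a1 a2 a3 a4) :
    HasExpansion l e (fun x => r * f x) (fun x => r * a0 x) (fun x => r * a1 x)
      (fun x => r * a2 x) (fun x => r * a3 x) (fun x => r * a4 x) :=
  ⟨h.b0.const_mul_left r, h.b1.const_mul_left r, h.b2.const_mul_left r, h.b3.const_mul_left r,
    h.b4.const_mul_left r, (h.rem.const_mul_left r).congr_left fun x => by ring⟩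

theorem mul (he : e =O[l] fun _ => (1 : ℝ)) (h : HasExpansion l e f a0 a1 a2 a3 a4)
    (k : HasExpansion l e g b0 b1 b2 b3 b4) :
    HasExpansion l e (fun x => f x * g x) (fun x => a0 x * b0 x)
      (fun x => a0 x * b1 x + a1 x * b0 x)
      (fun x => a0 x * b2 x + a1 x * b1 x + a2 x * b0 x)
      (fun x => a0 x * b3 x + a1 x * b2 x + a2 x * b1 x + a3 x * b0 x)
      (fun x => a0 x * b4 x + a1 x * b3 x + a2 x * b2 x + a3 x * b1 x + a4 x * b0 x) := by
  have m {p q : α → ℝ} := @isBigO_one_mul α l p q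
  refine ⟨m h.b0 k.b0, (m h.b0 k.b1).add (m h.b1 k.b0),
    ((m h.b0 k.b2).add (m h.b1 k.b1)).add (m h.b2 k.b0),
    (((m h.b0 k.b3).add (m h.b1 k.b2)).add (m h.b2 k.b1)).add (m h.b3 k.b0),
    ((((m h.b0 k.b4).add (m h.b1 k.b3)).add (m h.b2 k.b2)).add (m h.b3 k.b1)).add
      (m h.b4 k.b0), ?_⟩
  have r1 := h.rem.mul (k.isBigO_one he)
  have r2 := (h.isBigO_poly he).mul k.rem
  have r3 := isBigO_mul_one (g := fun x => e x ^ 5)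
    (((((m h.b1 k.b4).add (m h.b2 k.b3)).add (m h.b3 k.b2)).add (m h.b4 k.b1)).add
    (((m he (((m h.b2 k.b4).add (m h.b3 k.b3)).add (m h.b4 k.b2))).add
    (m (isBigO_one_pow he 2) ((m h.b3 k.b4).add (m h.b4 k.b3)))).add
    (m (isBigO_one_pow he 3) (m h.b4 k.b4))))
  simp only [mul_one, one_mul] at r1 r2
  exact ((r1.add r2).add r3).congr_left fun x => by ring

/-- The old top term becomes a4 e^5 and is absorbed by the remainder. -/
theorem shift (he : e =O[l] fun _ => (1 : ℝ)) (h : HasExpansion l e f a0 a1 a2 a3 a4) :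
    HasExpansion l e (fun x => e x * f x) (fun _ => 0) a0 a1 a2 a3 := by
  refine ⟨isBigO_one_const _, h.b0, h.b1, h.b2, h.b3, ?_⟩
  have r1 := h.rem.mul he
  have r2 := isBigO_mul_one (g := fun x => e x ^ 5) h.b4
  simp only [mul_one] at r1
  exact (r1.add r2).congr_left fun x => by ring

theorem isBigO_pow_five (h : HasExpansion l e f a0 a1 a2 a3 a4) (h0 : ∀ x, a0 x = 0)
    (h1 : ∀ x, a1 x = 0) (h2 : ∀ x, a2 x = 0) (h3 : ∀ x, a3 x = 0) (h4 : ∀ x, a4 x = 0) :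
    f =O[l] fun x => e x ^ 5 :=
  h.rem.congr_left fun x => by simp [h0, h1, h2, h3, h4]

theorem isBigO_self (he : e =O[l] fun _ => (1 : ℝ))
    (h : HasExpansion l e f (fun _ => 0) a1 a2 a3 a4) : f =O[l] e := by
  have r1 := (isBigO_refl e l).mul (isBigO_one_pow he 4)
  have r2 := isBigO_mul_one (g := e) (((h.b1.add (isBigO_one_mul h.b2 he)).add
    (isBigO_one_mul h.b3 (isBigO_one_pow he 2))).add (isBigO_one_mul h.b4 (isBigO_one_pow he 3)))
  have r3 : (fun x => e x ^ 5) =O[l] e := (r1.congr_left fun x => by ring).trans (by simpa using isBigO_refl e l)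
  exact ((h.rem.trans r3).add r2).congr_left fun x => by ring

/-- The fourth power of `1 + O(e)`. -/
theorem pow_four (he : e =O[l] fun _ => (1 : ℝ))
    (h : HasExpansion l e f (fun _ => 1) a1 a2 a3 a4) :
    HasExpansion l e (fun x => f x ^ 4) (fun _ => 1) (fun x => 4 * a1 x)
      (fun x => 4 * a2 x + 6 * a1 x ^ 2)
      (fun x => 4 * a3 x + 12 * a1 x * a2 x + 4 * a1 x ^ 3)
      (fun x => 4 * a4 x + 12 * a1 x * a3 x + 6 * a2 x ^ 2 + 12 * a1 x ^ 2 * a2 x + a1 x ^ 4) :=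
  ((h.mul he h).mul he (h.mul he h)).congr' (Eventually.of_forall fun x => by ring)
    (fun x => by ring) (fun x => by ring) (fun x => by ring) (fun x => by ring) (fun x => by ring)

/-- Taylor's formula for log(1 - u) with u = 1 - f = O(e). Convergence of e to 0, not mere
boundedness, is needed to have |u| < 1/2 eventually. -/
theorem log (he : Tendsto e l (nhds 0)) (h : HasExpansion l e f (fun _ => 1) a1 a2 a3 a4) :
    HasExpansion l e (fun x => Real.log (f x)) (fun _ => 0) a1
      (fun x => a2 x - a1 x ^ 2 / 2)
      (fun x => a3 x - a1 x * a2 x + a1 x ^ 3 / 3)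
      (fun x => a4 x - a1 x * a3 x - a2 x ^ 2 / 2 + a1 x ^ 2 * a2 x - a1 x ^ 4 / 4) := by
  have he1 : e =O[l] fun _ => (1 : ℝ) := he.isBigO_one ℝ
  have u : HasExpansion l e (fun x => 1 - f x) (fun _ => 0) (fun x => -a1 x) (fun x => -a2 x)
      (fun x => -a3 x) (fun x => -a4 x) :=
    ((const 1).add (h.const_mul (-1))).congr' (Eventually.of_forall fun x => by ring)
      (fun x => by ring) (fun x => by ring) (fun x => by ring) (fun x => by ring)
      (fun x => by ring)
  have ue := u.isBigO_self he1
  have ut : Tendsto (fun x => 1 - f x) l (nhds 0) := ue.trans_tendsto he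
  have u2 := u.mul he1 u
  have s := (((u.const_mul (-1)).add (u2.const_mul (-1 / 2))).add
    ((u2.mul he1 u).const_mul (-1 / 3))).add ((u2.mul he1 u2).const_mul (-1 / 4))
  have r : (fun x => Real.log (f x) - (-1 * (1 - f x) + -1 / 2 * ((1 - f x) * (1 - f x)) +
      -1 / 3 * ((1 - f x) * (1 - f x) * (1 - f x)) +
      -1 / 4 * ((1 - f x) * (1 - f x) * ((1 - f x) * (1 - f x))))) =O[l] fun x => e x ^ 5 := by
    refine IsBigO.trans ?_ (ue.pow 5)
    refine IsBigO.of_bound 2 ?_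
    have hs : ∀ᶠ x in l, |1 - f x| < 1 / 2 := by
      have := ut.abs
      rw [abs_zero] at this
      exact this.eventually (gt_mem_nhds (by norm_num))
    filter_upwards [hs] with x hx
    have := Real.abs_log_sub_add_sum_range_le (x := 1 - f x) (by linarith) 4
    rw [Real.norm_eq_abs, Real.norm_eq_abs, abs_pow]
    simp only [Finset.sum_range_succ, Finset.sum_range_zero] at this
    calc _ ≤ |1 - f x| ^ 5 / (1 - |1 - f x|) := by
            refine le_trans (le_of_eq (congrArg abs ?_)) this
            rw [sub_sub_cancel]
            push_cast
            ring
      _ ≤ 2 * |1 - f x| ^ 5 := by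
            rw [div_le_iff₀ (by linarith)]
            have : 0 ≤ |1 - f x| ^ 5 := by positivity
            nlinarith
  have s' : HasExpansion l e (fun x => Real.log (f x)) _ _ _ _ _ :=
    ⟨s.b0, s.b1, s.b2, s.b3, s.b4, (r.add s.rem).congr_left fun x => by ring⟩
  exact s'.congr' (Eventually.of_forall fun x => rfl)
      (fun x => by ring) (fun x => by ring) (fun x => by ring) (fun x => by ring)
      (fun x => by ring)

end HasExpansion

/-! ### Taylor expansion of the Fresnel integral at 0 -/

/-- Real part of the bound for the exponential series at iu cut after 12 terms; odd powers are
imaginary and drop out. -/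
theorem abs_cos_sub_taylor_le {u : ℝ} (hu : |u| ≤ 1) :
    |Real.cos u - (1 - u ^ 2 / 2 + u ^ 4 / 24 - u ^ 6 / 720 + u ^ 8 / 40320
      - u ^ 10 / 3628800)| ≤ |u| ^ 12 := by
  have hn : ‖(u : ℂ) * Complex.I‖ = |u| := by simp
  have h := Complex.exp_bound (x := u * Complex.I) (by rw [hn]; exact hu) (n := 12) (by norm_num)
  have hI : ∀ k : ℕ, ((u : ℂ) * Complex.I) ^ (2 * k) = (((-1) ^ k * u ^ (2 * k) : ℝ) : ℂ) := by
    intro k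
    rw [mul_pow, pow_mul Complex.I, Complex.I_sq]
    push_cast
    ring
  have hI' : ∀ k : ℕ, ((u : ℂ) * Complex.I) ^ (2 * k + 1)
      = (((-1) ^ k * u ^ (2 * k + 1) : ℝ) : ℂ) * Complex.I := by
    intro k
    rw [pow_succ, hI]
    push_cast
    ring
  have hsum : (∑ m ∈ Finset.range 12, ((u : ℂ) * Complex.I) ^ m / m.factorial).re
      = 1 - u ^ 2 / 2 + u ^ 4 / 24 - u ^ 6 / 720 + u ^ 8 / 40320 - u ^ 10 / 3628800 := by
    have e0 := hI 0
    have e1 := hI 1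
    have e2 := hI 2
    have e3 := hI 3
    have e4 := hI 4
    have e5 := hI 5
    have o0 := hI' 0
    have o1 := hI' 1
    have o2 := hI' 2
    have o3 := hI' 3
    have o4 := hI' 4
    have o5 := hI' 5
    norm_num only at e0 e1 e2 e3 e4 e5 o0 o1 o2 o3 o4 o5
    simp only [Finset.sum_range_succ, Finset.sum_range_zero, e0, e1, e2, e3, e4, e5, o0, o1, o2,
      o3, o4, o5, Complex.add_re, Complex.div_natCast_re, Complex.re_ofReal_mul, Complex.I_re,
      Complex.ofReal_re]
    norm_num [Nat.factorial]
    ring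
  have hre := (Complex.abs_re_le_norm _).trans h
  rw [Complex.sub_re, hsum, Complex.exp_ofReal_mul_I_re, hn] at hre
  refine hre.trans (mul_le_of_le_one_right (by positivity) ?_)
  norm_num [Nat.factorial]

/-- The natural variable `π² x⁴ / 10` of the iteration of the Fresnel cosine near `0`. -/
noncomputable def fresnelVar (x : ℝ) : ℝ := Real.pi ^ 2 * x ^ 4 / 10

theorem hasDerivAt_fresnelCos (x : ℝ) :
    HasDerivAt fresnelCos (Real.cos (Real.pi / 2 * x ^ 2)) x := by
  have hc : Continuous fun t : ℝ => Real.cos (Real.pi / 2 * t ^ 2) := by fun_prop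
  exact intervalIntegral.integral_hasDerivAt_right (hc.intervalIntegrable _ _)
    hc.aestronglyMeasurable.stronglyMeasurableAtFilter hc.continuousAt

@[simp]
theorem fresnelCos_zero : fresnelCos 0 = 0 := by simp [fresnelCos]

theorem continuous_fresnelCos : Continuous fresnelCos :=
  continuous_iff_continuousAt.2 fun x => (hasDerivAt_fresnelCos x).continuousAt

/-- The polynomial is the termwise integral of the Taylor polynomial of the cosine, so the cosine
error, at most (π/2)^12 x^24 on [0, x], is integrated. The bound on x keeps the argument of the
cosine within [0, 1]. -/
theorem exists_abs_fresnelCos_sub_taylor_le : ∃ K : ℝ, ∀ x : ℝ, 0 < x → x ≤ 1 / 2 →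
    |fresnelCos x - x * (1 - 1 / 4 * fresnelVar x + 25 / 864 * fresnelVar x ^ 2
      - 25 / 14976 * fresnelVar x ^ 3 + 125 / 2193408 * fresnelVar x ^ 4
      - 125 / 97542144 * fresnelVar x ^ 5)| ≤ K * x ^ 25 := by
  refine ⟨(Real.pi / 2) ^ 12, fun x hx hx2 => ?_⟩
  have hpi := Real.pi_pos
  have hpi4 := Real.pi_le_four
  have hd : ∀ t : ℝ, HasDerivAt (fun x => fresnelCos x - x * (1 - 1 / 4 * fresnelVar x
      + 25 / 864 * fresnelVar x ^ 2 - 25 / 14976 * fresnelVar x ^ 3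
      + 125 / 2193408 * fresnelVar x ^ 4 - 125 / 97542144 * fresnelVar x ^ 5))
      (Real.cos (Real.pi / 2 * t ^ 2) - (1 - (Real.pi / 2 * t ^ 2) ^ 2 / 2
        + (Real.pi / 2 * t ^ 2) ^ 4 / 24 - (Real.pi / 2 * t ^ 2) ^ 6 / 720
        + (Real.pi / 2 * t ^ 2) ^ 8 / 40320 - (Real.pi / 2 * t ^ 2) ^ 10 / 3628800)) t := by
    intro t
    have hv : HasDerivAt fresnelVar (Real.pi ^ 2 * (4 * t ^ 3) / 10) t := by
      refine (((hasDerivAt_pow 4 t).const_mul (Real.pi ^ 2)).div_const 10).congr_deriv ?_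
      norm_num
    have := (hasDerivAt_fresnelCos t).sub ((hasDerivAt_id t).mul
      ((((((hasDerivAt_const t (1 : ℝ)).sub (hv.const_mul (1 / 4))).add
      ((hv.pow 2).const_mul (25 / 864))).sub ((hv.pow 3).const_mul (25 / 14976))).add
      ((hv.pow 4).const_mul (125 / 2193408))).sub ((hv.pow 5).const_mul (125 / 97542144))))
    refine this.congr_deriv ?_
    simp only [fresnelVar, id, Pi.add_apply, Pi.sub_apply, Pi.pow_apply]
    push_cast
    ring
  have hI := intervalIntegral.integral_eq_sub_of_hasDerivAt (a := 0) (b := x) (fun t _ => hd t)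
    (Continuous.intervalIntegrable (by fun_prop) _ _)
  rw [fresnelCos_zero, zero_mul, sub_zero, sub_zero] at hI
  rw [← hI, ← Real.norm_eq_abs]
  refine (intervalIntegral.norm_integral_le_of_norm_le_const
    (C := (Real.pi / 2) ^ 12 * x ^ 24) fun t ht => ?_).trans (le_of_eq ?_)
  · rw [Set.uIoc_of_le hx.le] at ht
    have ht2 : t ^ 2 ≤ 1 / 4 := by nlinarith [ht.1, ht.2]
    have hu : |Real.pi / 2 * t ^ 2| = Real.pi / 2 * t ^ 2 := abs_of_nonneg (by positivity)
    rw [Real.norm_eq_abs]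
    refine (abs_cos_sub_taylor_le (by rw [hu]; nlinarith)).trans ?_
    rw [hu, mul_pow, ← pow_mul]
    gcongr
    · exact ht.1.le
    · exact ht.2
  · rw [sub_zero, abs_of_pos hx]
    ring

/-! ### Positive orbits decrease to 0 -/

/-- The derivative 1 - cos of x - f(x) is nonnegative everywhere but has positive zeros; strict
growth is taken from [0, 1] alone and monotonicity carries it further. -/
theorem fresnelCos_lt_self {x : ℝ} (hx : 0 < x) : fresnelCos x < x := by
  have hd : ∀ t : ℝ, HasDerivAt (fun t => t - fresnelCos t)
      (1 - Real.cos (Real.pi / 2 * t ^ 2)) t := fun t =>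
    (hasDerivAt_id t).sub (hasDerivAt_fresnelCos t)
  have hmono : Monotone fun t => t - fresnelCos t :=
    monotone_of_deriv_nonneg (fun t => (hd t).differentiableAt) fun t => by
      rw [(hd t).deriv]
      linarith [Real.cos_le_one (Real.pi / 2 * t ^ 2)]
  have hs : StrictMonoOn (fun t => t - fresnelCos t) (Set.Icc 0 1) := by
    refine strictMonoOn_of_deriv_pos (convex_Icc 0 1)
      (fun t _ => (hd t).continuousAt.continuousWithinAt) fun t ht => ?_
    rw [interior_Icc] at ht
    rw [(hd t).deriv, sub_pos]
    have hp := Real.pi_pos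
    have ht2 : t ^ 2 ≤ 1 := by nlinarith [ht.1, ht.2]
    have ht3 : 0 < t ^ 2 := by have := ht.1; positivity
    have := Real.cos_lt_cos_of_nonneg_of_le_pi le_rfl (y := Real.pi / 2 * t ^ 2) (by nlinarith)
      (by positivity)
    rwa [Real.cos_zero] at this
  have h0 : (0 : ℝ) < min x 1 := lt_min hx one_pos
  have h1 := hs (by simp) ⟨h0.le, min_le_right x 1⟩ h0
  have h2 := hmono (min_le_left x 1)
  simp only [fresnelCos_zero, sub_zero] at h1 h2
  linarith

theorem sub_le_fresnelCos {x : ℝ} (hx : 0 ≤ x) :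
    x - Real.pi ^ 2 / 40 * x ^ 5 ≤ fresnelCos x := by
  have hd : ∀ t : ℝ, HasDerivAt (fun t => fresnelCos t - (t - Real.pi ^ 2 / 40 * t ^ 5))
      (Real.cos (Real.pi / 2 * t ^ 2) - (1 - Real.pi ^ 2 / 40 * (5 * t ^ 4))) t := fun t => by
    refine ((hasDerivAt_fresnelCos t).sub ((hasDerivAt_id t).sub
      ((hasDerivAt_pow 5 t).const_mul (Real.pi ^ 2 / 40)))).congr_deriv ?_
    norm_num
  have hmono : Monotone fun t => fresnelCos t - (t - Real.pi ^ 2 / 40 * t ^ 5) :=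
    monotone_of_deriv_nonneg (fun t => (hd t).differentiableAt) fun t => by
      rw [(hd t).deriv]
      have := Real.one_sub_sq_div_two_le_cos (x := Real.pi / 2 * t ^ 2)
      ring_nf at this ⊢
      linarith
  have := hmono hx
  simp only [fresnelCos_zero] at this
  norm_num at this
  linarith

theorem fresnelCos_pos {x : ℝ} (hx : 0 < x) : 0 < fresnelCos x := by
  have hp := Real.pi_pos
  have hp3 := Real.pi_gt_three
  have hp4 := Real.pi_lt_d2
  rcases le_or_gt x 1 with h1 | h1
  · have h := sub_le_fresnelCos hx.le
    have h4 : x ^ 4 ≤ 1 := pow_le_one₀ hx.le h1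
    have : Real.pi ^ 2 / 40 * x ^ 4 < 1 := by nlinarith
    nlinarith
  -- Integration by parts: subtracting (sin + 1)/(πt), rather than sin/(πt), makes the remaining
  -- derivative nonnegative. Positivity then follows from f(1) ≥ 1 - π²/40 > 0.7 > 2/π.
  · have hd : ∀ t : ℝ, 0 < t → HasDerivAt
        (fun t => fresnelCos t - (Real.sin (Real.pi / 2 * t ^ 2) + 1) / (Real.pi * t))
        ((Real.sin (Real.pi / 2 * t ^ 2) + 1) / (Real.pi * t ^ 2)) t := fun t ht => by
      have hin : HasDerivAt (fun t : ℝ => Real.pi / 2 * t ^ 2) (Real.pi * t) t := by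
        refine ((hasDerivAt_pow 2 t).const_mul (Real.pi / 2)).congr_deriv ?_
        push_cast
        ring
      have := (hasDerivAt_fresnelCos t).sub ((hin.sin.add_const 1).div
        ((hasDerivAt_id t).const_mul Real.pi) (by positivity))
      refine this.congr_deriv ?_
      simp only [id]
      field_simp
      ring
    have hmono : MonotoneOn (fun t => fresnelCos t
        - (Real.sin (Real.pi / 2 * t ^ 2) + 1) / (Real.pi * t)) (Set.Ici 1) := by
      refine monotoneOn_of_deriv_nonneg (convex_Ici 1) (fun t ht =>
        (hd t (zero_lt_one.trans_le ht)).continuousAt.continuousWithinAt) (fun t ht => ?_)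
        fun t ht => ?_
      · rw [interior_Ici] at ht
        exact (hd t (zero_lt_one.trans ht)).differentiableAt.differentiableWithinAt
      · rw [interior_Ici] at ht
        rw [(hd t (zero_lt_one.trans ht)).deriv]
        have := Real.neg_one_le_sin (Real.pi / 2 * t ^ 2)
        have : 0 ≤ Real.sin (Real.pi / 2 * t ^ 2) + 1 := by linarith
        positivity
    have h := hmono (Set.self_mem_Ici) h1.le h1.le
    have hf1 := sub_le_fresnelCos zero_le_one
    simp only [one_pow, mul_one, Real.sin_pi_div_two] at h hf1
    have hs := Real.neg_one_le_sin (Real.pi / 2 * x ^ 2)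
    have h2 : (1 + 1) / Real.pi < 0.7 := by rw [div_lt_iff₀ hp]; linarith
    have h3 : 0 ≤ (Real.sin (Real.pi / 2 * x ^ 2) + 1) / (Real.pi * x) :=
      div_nonneg (by linarith) (by positivity)
    nlinarith

section Iteration

variable {x : ℕ → ℝ}

theorem fresnelCos_iterate_pos (hx0 : 0 < x 0) (hx : ∀ n : ℕ, x (n + 1) = fresnelCos (x n))
    (n : ℕ) : 0 < x n := by
  induction n with
  | zero => exact hx0
  | succ n ih => rw [hx]; exact fresnelCos_pos ih

theorem tendsto_fresnelCos_iterate (hx0 : 0 < x 0)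
    (hx : ∀ n : ℕ, x (n + 1) = fresnelCos (x n)) : Tendsto x atTop (nhdsWithin 0 (Set.Ioi 0)) := by
  have hpos := fresnelCos_iterate_pos hx0 hx
  have hanti : Antitone x := antitone_nat_of_succ_le fun n => by
    rw [hx]; exact (fresnelCos_lt_self (hpos n)).le
  have hlim := tendsto_atTop_ciInf hanti ⟨0, by rintro _ ⟨n, rfl⟩; exact (hpos n).le⟩
  set L := ⨅ n, x n
  have hL0 : 0 ≤ L := ge_of_tendsto' hlim fun n => (hpos n).le
  have hL : fresnelCos L = L := by
    refine tendsto_nhds_unique ?_ (hlim.comp (tendsto_add_atTop_nat 1))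
    refine ((continuous_fresnelCos.tendsto L).comp hlim).congr fun n => ?_
    simp [hx]
  have : L = 0 := by
    by_contra h
    exact (fresnelCos_lt_self (lt_of_le_of_ne hL0 (Ne.symm h))).ne hL
  rw [this] at hlim
  exact tendsto_nhdsWithin_iff.2 ⟨hlim, Eventually.of_forall hpos⟩

end Iteration

/-! ### The approximate Abel equation -/

theorem tendsto_fresnelVar : Tendsto fresnelVar (nhdsWithin 0 (Set.Ioi 0)) (nhds 0) := by
  have : Continuous fresnelVar := by unfold fresnelVar; fun_prop
  have h := this.tendsto 0
  simp only [fresnelVar, ne_eq, OfNat.ofNat_ne_zero, not_false_eq_true, zero_pow, mul_zero,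
    zero_div] at h
  exact h.mono_left nhdsWithin_le_nhds

theorem fresnelVar_pos {x : ℝ} (hx : 0 < x) : 0 < fresnelVar x := by
  have := Real.pi_pos
  unfold fresnelVar
  positivity

/-- Expanding the quotient (f(x)/x - 1)/z retains the z^5 coefficient of f(x)/x. That extra order is
needed because the Abel function contains 1/z. -/
theorem hasExpansion_fresnelCos_div_sub_one : HasExpansion (nhdsWithin 0 (Set.Ioi 0)) fresnelVar
    (fun x => (fresnelCos x / x - 1) / fresnelVar x) (fun _ => -1 / 4) (fun _ => 25 / 864)
    (fun _ => -25 / 14976) (fun _ => 125 / 2193408) (fun _ => -125 / 97542144) := by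
  refine ⟨isBigO_one_const _, isBigO_one_const _, isBigO_one_const _, isBigO_one_const _,
    isBigO_one_const _, ?_⟩
  obtain ⟨K, hK⟩ := exists_abs_fresnelCos_sub_taylor_le
  refine IsBigO.of_bound (K * (10 / Real.pi ^ 2) ^ 6) ?_
  have hlt : ∀ᶠ x : ℝ in nhdsWithin 0 (Set.Ioi 0), x < 1 / 2 :=
    nhdsWithin_le_nhds (gt_mem_nhds (by norm_num))
  filter_upwards [self_mem_nhdsWithin, hlt] with x hx hx2
  have hx : 0 < x := hx
  have hv := fresnelVar_pos hx
  have hp := Real.pi_pos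
  rw [Real.norm_eq_abs, Real.norm_eq_abs, abs_of_pos (pow_pos hv 5)]
  have h := hK x hx hx2.le
  have e1 : (fresnelCos x / x - 1) / fresnelVar x - (-1 / 4 + 25 / 864 * fresnelVar x
      + -25 / 14976 * fresnelVar x ^ 2 + 125 / 2193408 * fresnelVar x ^ 3
      + -125 / 97542144 * fresnelVar x ^ 4) = (fresnelCos x - x * (1 - 1 / 4 * fresnelVar x
      + 25 / 864 * fresnelVar x ^ 2 - 25 / 14976 * fresnelVar x ^ 3
      + 125 / 2193408 * fresnelVar x ^ 4 - 125 / 97542144 * fresnelVar x ^ 5))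
      / (x * fresnelVar x) := by
    field_simp
    ring
  rw [e1, abs_div, abs_of_pos (mul_pos hx hv), div_le_iff₀ (mul_pos hx hv)]
  refine h.trans (le_of_eq ?_)
  unfold fresnelVar
  field_simp

/-- The truncated Abel function of the iteration, as a function of `fresnelVar x`. -/
noncomputable def fresnelAbel (z : ℝ) : ℝ :=
  1 / z + 55 / 108 * Real.log z + 25745 / 151632 * z + 250903475 / 3897548928 * z ^ 2
    + 124092693449 / 3379862723328 * z ^ 3

theorem fresnelAbel_mul_pow_four {z g : ℝ} (hz : 0 < z) (hg : 0 < g) :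
    fresnelAbel (z * g ^ 4) = 1 / z * (1 / g ^ 4) + 55 / 108 * (Real.log z + 4 * Real.log g)
      + 25745 / 151632 * (z * g ^ 4) + 250903475 / 3897548928 * (z * g ^ 4) ^ 2
      + 124092693449 / 3379862723328 * (z * g ^ 4) ^ 3 := by
  unfold fresnelAbel
  rw [Real.log_mul hz.ne' (by positivity), Real.log_pow]
  push_cast
  rw [one_div_mul_one_div]

theorem fresnelAbel_fresnelCos_sub :
    (fun x => fresnelAbel (fresnelVar (fresnelCos x)) - fresnelAbel (fresnelVar x) - 1)
      =O[nhdsWithin 0 (Set.Ioi 0)] fun x => fresnelVar x ^ 5 := by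
  have he := tendsto_fresnelVar
  have he1 : fresnelVar =O[nhdsWithin 0 (Set.Ioi 0)] fun _ => (1 : ℝ) := he.isBigO_one ℝ
  have hh := hasExpansion_fresnelCos_div_sub_one
  set g : ℝ → ℝ := fun x => fresnelCos x / x with hgdef
  have hg : HasExpansion (nhdsWithin 0 (Set.Ioi 0)) fresnelVar g (fun _ => 1) (fun _ => -1 / 4)
      (fun _ => 25 / 864) (fun _ => -25 / 14976) (fun _ => 125 / 2193408) := by
    refine ((HasExpansion.const 1).add (hh.shift he1)).congr' ?_ (fun _ => by norm_num)
      (fun _ => by norm_num) (fun _ => by norm_num) (fun _ => by norm_num) (fun _ => by norm_num)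
    filter_upwards [self_mem_nhdsWithin] with x hx
    have := fresnelVar_pos hx
    field_simp
    ring
  have hg4 := hg.pow_four he1
  have hl := hg.log he
  have h2 := hh.mul he1 hh
  -- This is (g^4 - 1)/z written as a polynomial in z and h = (g - 1)/z, so the division by z loses
  -- no order.
  have hk := (((hh.const_mul 4).add ((h2.const_mul 6).shift he1)).add
    ((((h2.mul he1 hh).const_mul 4).shift he1).shift he1)).add
    (((h2.mul he1 h2).shift he1).shift he1 |>.shift he1)
  have hm4 := hg4.add (HasExpansion.const (-1))
  have hm8 := (hg4.mul he1 hg4).add (HasExpansion.const (-1))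
  have hm12 := ((hg4.mul he1 hg4).mul he1 hg4).add (HasExpansion.const (-1))
  -- The Abel defect multiplied by g^4, which avoids expanding 1/g^4.
  have key := (hk.const_mul (-1)).add (hg4.mul he1 (((((hl.const_mul (4 * (55 / 108))).add
    (HasExpansion.const (-1))).add ((hm4.const_mul (25745 / 151632)).shift he1)).add
    (((hm8.const_mul (250903475 / 3897548928)).shift he1).shift he1)).add
    ((((hm12.const_mul (124092693449 / 3379862723328)).shift he1).shift he1).shift he1)))
  -- The constant term cancels by the normalisation of z; the next four orders determine, in turn,
  -- 55/108 and the three polynomial coefficients of `fresnelAbel`.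
  have hO := key.isBigO_pow_five (fun _ => by norm_num) (fun _ => by norm_num)
    (fun _ => by norm_num) (fun _ => by norm_num) (fun _ => by norm_num)
  have hg1 : Tendsto g (nhdsWithin 0 (Set.Ioi 0)) (nhds 1) := by
    have := ((hh.isBigO_one he1).mul (isBigO_refl fresnelVar _)).trans_tendsto
      (by simpa using he)
    have := this.const_add 1
    rw [add_zero] at this
    refine this.congr' ?_
    filter_upwards [self_mem_nhdsWithin] with x hx
    have := fresnelVar_pos hx
    field_simp
    ring
  have hinv : (fun x => (g x ^ 4)⁻¹) =O[nhdsWithin 0 (Set.Ioi 0)] fun _ => (1 : ℝ) :=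
    ((hg1.pow 4).inv₀ (by norm_num)).isBigO_one ℝ
  refine (((isBigO_refl _ _).mul hinv).trans (by simpa using hO)).congr' ?_ EventuallyEq.rfl
  filter_upwards [self_mem_nhdsWithin] with x hx
  have hx : 0 < x := hx
  have hv := fresnelVar_pos hx
  have hgx : 0 < g x := div_pos (fresnelCos_pos hx) hx
  have e1 : fresnelVar (fresnelCos x) = fresnelVar x * g x ^ 4 := by
    simp only [fresnelVar, hgdef]
    field_simp
  rw [e1, fresnelAbel_mul_pow_four hv hgx, fresnelAbel]
  change _ * (g x ^ 4)⁻¹ = _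
  rw [show fresnelCos x / x = g x from rfl]
  generalize g x = G at *
  generalize fresnelVar x = z at *
  field_simp
  ring

/-! ### The Abel function along an orbit -/

theorem exists_isBigO_of_succ_sub_isBigO {s : ℕ → ℝ}
    (hs : (fun n => s (n + 1) - s n) =O[atTop] fun n : ℕ => 1 / (n : ℝ) ^ 5) :
    ∃ L : ℝ, (fun n => s n - L) =O[atTop] fun n : ℕ => 1 / (n : ℝ) ^ 4 := by
  obtain ⟨K, hK0, hK⟩ := hs.exists_pos
  obtain ⟨N, hN⟩ := eventually_atTop.1 hK.bound
  -- A telescoping majorant: (n+1)^4 - n^4 ≥ 4n^3 and (n+1)^4 ≤ 16n^4 give the factor 4.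
  have hstep : ∀ n : ℕ, max N 1 ≤ n →
      |s (n + 1) - s n| ≤ 4 * K / (n : ℝ) ^ 4 - 4 * K / ((n + 1 : ℕ) : ℝ) ^ 4 := by
    intro n hn
    have hn1 : (1 : ℝ) ≤ n := by exact_mod_cast (le_max_right N 1).trans hn
    have hb := hN n ((le_max_left N 1).trans hn)
    rw [Real.norm_eq_abs, Real.norm_eq_abs, abs_of_pos (a := 1 / (n : ℝ) ^ 5) (by positivity)] at hb
    refine hb.trans ?_
    have h16 : ((n : ℝ) + 1) ^ 4 ≤ 16 * (n : ℝ) ^ 4 := by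
      calc ((n : ℝ) + 1) ^ 4 ≤ (2 * (n : ℝ)) ^ 4 := by gcongr; linarith
        _ = _ := by ring
    push_cast
    rw [div_sub_div _ _ (by positivity) (by positivity), mul_one_div,
      div_le_div_iff₀ (by positivity) (by positivity)]
    calc K * ((n : ℝ) ^ 4 * (n + 1) ^ 4) ≤ K * ((n : ℝ) ^ 4 * (16 * (n : ℝ) ^ 4)) := by gcongr
      _ ≤ _ := by
        have : 0 ≤ K * ((n : ℝ) ^ 7 * 24 + n ^ 6 * 16 + n ^ 5 * 4) := by positivity
        nlinarith
  have hsum : ∀ n : ℕ, max N 1 ≤ n → ∀ m, n ≤ m →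
      |s m - s n| ≤ 4 * K / (n : ℝ) ^ 4 - 4 * K / (m : ℝ) ^ 4 := by
    intro n hn m hm
    induction m, hm using Nat.le_induction with
    | base => simp
    | succ m hm ih =>
      have := hstep m (hn.trans hm)
      have := abs_sub_le (s (m + 1)) (s m) (s n)
      linarith
  have hsum' : ∀ n : ℕ, max N 1 ≤ n → ∀ m, n ≤ m → |s m - s n| ≤ 4 * K / (n : ℝ) ^ 4 :=
    fun n hn m hm => (hsum n hn m hm).trans (sub_le_self _ (by positivity))
  have hu : Tendsto (fun n : ℕ => 4 * K / (n : ℝ) ^ 4) atTop (nhds 0) :=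
    tendsto_const_nhds.div_atTop ((tendsto_pow_atTop (by norm_num)).comp
      tendsto_natCast_atTop_atTop)
  have hc : CauchySeq s := by
    refine Metric.cauchySeq_iff'.2 fun ε hε => ?_
    obtain ⟨n, hn, hnN⟩ := ((hu.eventually (gt_mem_nhds hε)).and
      (eventually_ge_atTop (max N 1))).exists
    exact ⟨n, fun m hm => (hsum' n hnN m hm).trans_lt hn⟩
  obtain ⟨L, hL⟩ := cauchySeq_tendsto_of_complete hc
  refine ⟨L, IsBigO.of_bound (4 * K) ?_⟩
  filter_upwards [eventually_ge_atTop (max N 1)] with n hn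
  rw [Real.norm_eq_abs, Real.norm_eq_abs, abs_of_nonneg (a := 1 / (n : ℝ) ^ 4) (by positivity),
    mul_one_div, abs_sub_comm]
  refine le_of_tendsto (hL.sub_const (s n)).abs ?_
  filter_upwards [eventually_ge_atTop n] with m hm
  exact hsum' n hn m hm

theorem tendsto_mul_fresnelAbel :
    Tendsto (fun z => z * fresnelAbel z) (nhdsWithin 0 (Set.Ioi 0)) (nhds 1) := by
  have h1 : Tendsto (fun z : ℝ => z * Real.log z) (nhdsWithin 0 (Set.Ioi 0)) (nhds 0) := by
    have := Real.continuous_mul_log.tendsto 0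
    simp only [zero_mul] at this
    exact this.mono_left nhdsWithin_le_nhds
  have h2 : Tendsto (fun z : ℝ => 1 + 25745 / 151632 * z ^ 2 + 250903475 / 3897548928 * z ^ 3
      + 124092693449 / 3379862723328 * z ^ 4) (nhdsWithin 0 (Set.Ioi 0)) (nhds 1) := by
    have : Continuous fun z : ℝ => 1 + 25745 / 151632 * z ^ 2 + 250903475 / 3897548928 * z ^ 3
      + 124092693449 / 3379862723328 * z ^ 4 := by fun_prop
    have := this.tendsto 0
    norm_num only at this
    exact this.mono_left nhdsWithin_le_nhds
  have h := (h1.const_mul (55 / 108)).add h2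
  rw [mul_zero, zero_add] at h
  refine h.congr' ?_
  filter_upwards [self_mem_nhdsWithin] with z hz
  have hz : 0 < z := hz
  unfold fresnelAbel
  field_simp
  ring

/-- The term 1/z dominates. With D = 1/z - 1/w ≥ 0, the logarithm contributes at most (55/108) D/4
and the polynomial at most D/16, which leaves more than D/2. No inverse of the Abel function is
needed. -/
theorem half_mul_abs_sub_le_fresnelAbel {z w : ℝ} (hz : 0 < z) (hw : 0 < w) (hz4 : z ≤ 1 / 4)
    (hw4 : w ≤ 1 / 4) : |1 / z - 1 / w| ≤ 2 * |fresnelAbel z - fresnelAbel w| := by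
  wlog hzw : z ≤ w generalizing z w
  · rw [abs_sub_comm, abs_sub_comm (fresnelAbel z)]
    exact this hw hz hw4 hz4 (le_of_not_ge hzw)
  set D := 1 / z - 1 / w with hD
  have hD0 : 0 ≤ D := sub_nonneg.2 (one_div_le_one_div_of_le hz hzw)
  have hlog : Real.log w - Real.log z ≤ w * D := by
    rw [← Real.log_div hw.ne' hz.ne']
    refine (Real.log_le_sub_one_of_pos (by positivity)).trans (le_of_eq ?_)
    rw [hD]
    field_simp
  have hdiff : w - z = z * w * D := by
    rw [hD]
    field_simp
  have hzw16 : z * w ≤ 1 / 16 := by nlinarith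
  have e : fresnelAbel z - fresnelAbel w = D - 55 / 108 * (Real.log w - Real.log z)
      - (w - z) * (25745 / 151632 + 250903475 / 3897548928 * (z + w)
        + 124092693449 / 3379862723328 * (z ^ 2 + z * w + w ^ 2)) := by
    rw [hD]
    unfold fresnelAbel
    ring
  have hc : 25745 / 151632 + 250903475 / 3897548928 * (z + w)
        + 124092693449 / 3379862723328 * (z ^ 2 + z * w + w ^ 2) ≤ 1 := by nlinarith
  have h1 : w - z ≤ 1 / 16 * D := by
    rw [hdiff]
    gcongr
  have h2 : w * D ≤ 1 / 4 * D := by gcongr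
  have h3 := mul_le_mul_of_nonneg_left hc (sub_nonneg.2 hzw)
  rw [abs_of_nonneg hD0]
  have := le_abs_self (fresnelAbel z - fresnelAbel w)
  linarith

section Iteration

variable {x : ℕ → ℝ}

theorem tendsto_fresnelVar_iterate (hx0 : 0 < x 0)
    (hx : ∀ n : ℕ, x (n + 1) = fresnelCos (x n)) :
    Tendsto (fun n => fresnelVar (x n)) atTop (nhdsWithin 0 (Set.Ioi 0)) :=
  tendsto_nhdsWithin_iff.2 ⟨tendsto_fresnelVar.comp (tendsto_fresnelCos_iterate hx0 hx),
    Eventually.of_forall fun n => fresnelVar_pos (fresnelCos_iterate_pos hx0 hx n)⟩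

theorem fresnelAbel_iterate_succ_sub (hx0 : 0 < x 0)
    (hx : ∀ n : ℕ, x (n + 1) = fresnelCos (x n)) :
    (fun n => fresnelAbel (fresnelVar (x (n + 1))) - fresnelAbel (fresnelVar (x n)) - 1)
      =O[atTop] fun n => fresnelVar (x n) ^ 5 := by
  refine (fresnelAbel_fresnelCos_sub.comp_tendsto (tendsto_fresnelCos_iterate hx0 hx)).congr_left
    fun n => ?_
  simp [hx]

theorem fresnelVar_iterate_isBigO (hx0 : 0 < x 0)
    (hx : ∀ n : ℕ, x (n + 1) = fresnelCos (x n)) :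
    (fun n => fresnelVar (x n)) =O[atTop] fun n : ℕ => 1 / (n : ℝ) := by
  have hz := tendsto_fresnelVar_iterate hx0 hx
  have hd : Tendsto (fun n => fresnelAbel (fresnelVar (x (n + 1))) - fresnelAbel (fresnelVar (x n)))
      atTop (nhds 1) := by
    have h0 : Tendsto (fun n => fresnelVar (x n) ^ 5) atTop (nhds 0) := by
      simpa using (hz.mono_right nhdsWithin_le_nhds).pow 5
    have := ((fresnelAbel_iterate_succ_sub hx0 hx).trans_tendsto h0).add_const 1
    simpa using this
  have hces := hd.cesaro
  simp only [Finset.sum_range_sub (fun n => fresnelAbel (fresnelVar (x n)))] at hces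
  have h0 : Tendsto (fun n : ℕ => (n : ℝ)⁻¹ * fresnelAbel (fresnelVar (x 0))) atTop (nhds 0) := by
    simpa using (tendsto_inv_atTop_nhds_zero_nat (𝕜 := ℝ)).mul_const
      (fresnelAbel (fresnelVar (x 0)))
  have hΨ : Tendsto (fun n : ℕ => (n : ℝ)⁻¹ * fresnelAbel (fresnelVar (x n))) atTop (nhds 1) := by
    have := hces.add h0
    rw [add_zero] at this
    exact this.congr fun n => by ring
  -- With A the Abel function, z_n A(z_n) divided by A(z_n)/n is n z_n, which therefore tends to 1.
  have hq := (tendsto_mul_fresnelAbel.comp hz).div hΨ one_ne_zero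
  rw [div_one] at hq
  have hb := (isBigO_refl (fun n : ℕ => 1 / (n : ℝ)) atTop).mul (hq.isBigO_one ℝ)
  simp only [mul_one] at hb
  refine hb.congr' ?_ EventuallyEq.rfl
  filter_upwards [hΨ.eventually (lt_mem_nhds one_pos), eventually_gt_atTop 0] with n hn hn0
  have hne : fresnelAbel (fresnelVar (x n)) ≠ 0 := by
    rintro h
    simp [h] at hn
  have : (n : ℝ) ≠ 0 := by positivity
  simp only [Pi.div_apply, Function.comp_apply]
  field_simp

theorem exists_fresnelAbel_iterate_isBigO (hx0 : 0 < x 0)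
    (hx : ∀ n : ℕ, x (n + 1) = fresnelCos (x n)) :
    ∃ C : ℝ, (fun n => fresnelAbel (fresnelVar (x n)) - (n - C))
      =O[atTop] fun n : ℕ => 1 / (n : ℝ) ^ 4 := by
  have h := (fresnelAbel_iterate_succ_sub hx0 hx).trans ((fresnelVar_iterate_isBigO hx0 hx).pow 5)
  obtain ⟨L, hL⟩ := exists_isBigO_of_succ_sub_isBigO
    (s := fun n => fresnelAbel (fresnelVar (x n)) - n)
    (h.congr (fun n => by push_cast; ring) (fun n => by simp))
  exact ⟨-L, hL.congr_left fun n => by ring⟩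

end Iteration

/-! ### Substituting the formula into the Abel function -/

/-- The factor `1 + ∑ Pₘ(-(b₁ ln n - C)/4) n⁻ᵐ` of `fresnelFormulaB`. -/
noncomputable def fresnelFactor (C : ℝ) (n : ℕ) : ℝ :=
  1 + ∑ m ∈ Finset.Icc 1 4,
      fresnelP m (-(1 / 4) * (55 / 108 * Real.log n - C)) * (1 / (n : ℝ) ^ m)

theorem tendsto_log_div_natCast :
    Tendsto (fun n : ℕ => Real.log n / (n : ℝ)) atTop (nhds 0) := by
  simpa [Function.comp_def] using
    Real.isLittleO_log_id_atTop.tendsto_div_nhds_zero.comp tendsto_natCast_atTop_atTop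

theorem tendsto_inv_log_natCast :
    Tendsto (fun n : ℕ => 1 / Real.log n) atTop (nhds 0) :=
  tendsto_const_nhds.div_atTop (Real.tendsto_log_atTop.comp tendsto_natCast_atTop_atTop)

theorem eventually_log_natCast_pos : ∀ᶠ n : ℕ in atTop, 0 < Real.log n :=
  (Real.tendsto_log_atTop.comp tendsto_natCast_atTop_atTop).eventually_gt_atTop 0

theorem isBigO_one_neg_quarter_div_log (C : ℝ) :
    (fun n : ℕ => -(1 / 4) * (55 / 108 * Real.log n - C) / Real.log n)
      =O[atTop] fun _ => (1 : ℝ) := by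
  have := (tendsto_inv_log_natCast.const_mul (C / 4)).const_add (-(55 / 432))
  refine (this.isBigO_one ℝ).congr' ?_ EventuallyEq.rfl
  filter_upwards [eventually_log_natCast_pos] with n hn
  field_simp
  ring

theorem fresnelFactor_eq (C : ℝ) (n : ℕ) : fresnelFactor C n =
    1 + fresnelP 1 (-(1 / 4) * (55 / 108 * Real.log n - C)) * (1 / (n : ℝ) ^ 1)
      + fresnelP 2 (-(1 / 4) * (55 / 108 * Real.log n - C)) * (1 / (n : ℝ) ^ 2)
      + fresnelP 3 (-(1 / 4) * (55 / 108 * Real.log n - C)) * (1 / (n : ℝ) ^ 3)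
      + fresnelP 4 (-(1 / 4) * (55 / 108 * Real.log n - C)) * (1 / (n : ℝ) ^ 4) := by
  rw [fresnelFactor, show Finset.Icc 1 4 = {1, 2, 3, 4} from rfl]
  simp only [Finset.mem_insert, Finset.mem_singleton, OfNat.one_ne_ofNat, or_self,
    not_false_eq_true, Finset.sum_insert, Finset.sum_singleton, Nat.reduceEqDiff]
  ring

/-- The scale is e = ln(n)/n. Writing X = a ln(n) and 1 = b ln(n) with a and b bounded homogenises
each P_m(X)/n^m into a form of degree m in (a, b) times e^m. -/
theorem hasExpansion_fresnelFactor (C : ℝ) {a b : ℕ → ℝ}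
    (ha : a = fun n : ℕ => -(1 / 4) * (55 / 108 * Real.log n - C) / Real.log n)
    (hb : b = fun n : ℕ => 1 / Real.log n) :
    HasExpansion atTop (fun n : ℕ => Real.log n / (n : ℝ)) (fresnelFactor C) (fun _ => 1) a
      (fun n => 5 / 2 * a n ^ 2 + 55 / 108 * a n * b n + 25745 / 606528 * b n ^ 2)
      (fun n => 15 / 2 * a n ^ 3 + 385 / 108 * a n ^ 2 * b n + 389005 / 606528 * a n * b n ^ 2
        + 587905525 / 15590195712 * b n ^ 3)
      (fun n => 195 / 8 * a n ^ 4 + 12485 / 648 * a n ^ 3 * b n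
        + 62045 / 10368 * a n ^ 2 * b n ^ 2 + 12734847275 / 15590195712 * a n * b n ^ 3
        + 73718758987739 / 1838645321490432 * b n ^ 4) := by
  have hA : a =O[atTop] fun _ => (1 : ℝ) := ha ▸ isBigO_one_neg_quarter_div_log C
  have hB : b =O[atTop] fun _ => (1 : ℝ) := hb ▸ tendsto_inv_log_natCast.isBigO_one ℝ
  have m {p q : ℕ → ℝ} := @isBigO_one_mul ℕ atTop p q
  have c (r : ℝ) {p : ℕ → ℝ} (h : p =O[atTop] fun _ => (1 : ℝ)) := h.const_mul_left r
  have pa := isBigO_one_pow hA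
  have pb := isBigO_one_pow hB
  refine ⟨isBigO_one_const _, hA, ((c _ (pa 2)).add (m (c _ hA) hB)).add (c _ (pb 2)),
    (((c _ (pa 3)).add (m (c _ (pa 2)) hB)).add (m (c _ hA) (pb 2))).add (c _ (pb 3)),
    ((((c _ (pa 4)).add (m (c _ (pa 3)) hB)).add (m (c _ (pa 2)) (pb 2))).add
      (m (c _ hA) (pb 3))).add (c _ (pb 4)), ?_⟩
  -- The expansion is exact once ln(n) > 0.
  refine (isBigO_zero _ _).congr' ?_ EventuallyEq.rfl
  filter_upwards [eventually_log_natCast_pos, eventually_gt_atTop 0] with n hn hn0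
  have hn0 : (n : ℝ) ≠ 0 := by positivity
  have hX : -(1 / 4) * (55 / 108 * Real.log n - C) = a n * Real.log n := by
    rw [ha]
    field_simp
  have hb' : b n * Real.log n = 1 := by
    rw [hb]
    field_simp
  rw [fresnelFactor_eq, hX]
  simp only [fresnelP]
  generalize a n = A at *
  generalize b n = B at *
  generalize Real.log n = L at *
  obtain rfl : B = 1 / L := by field_simp; exact hb'
  field_simp
  ring

theorem tendsto_fresnelFactor (C : ℝ) : Tendsto (fresnelFactor C) atTop (nhds 1) := by
  have he := tendsto_log_div_natCast
  have h := (((HasExpansion.const (-1)).add (hasExpansion_fresnelFactor C rfl rfl)).congr'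
    (Eventually.of_forall fun _ => rfl) (c0 := fun _ => 0) (fun _ => by norm_num) (fun _ => rfl)
    (fun _ => rfl) (fun _ => rfl) (fun _ => rfl)).isBigO_self (he.isBigO_one ℝ)
  simpa using (h.trans_tendsto he).const_add 1

/-- The residual of the factor in the equation that inverts the Abel function. -/
theorem fresnelFactor_residual_isBigO (C : ℝ) :
    (fun n : ℕ => 1 / fresnelFactor C n ^ 4 - 1
      + (-(55 / 108 * Real.log n - C)) * (1 / (n : ℝ))
      + 4 * (55 / 108) * (1 / (n : ℝ)) * Real.log (fresnelFactor C n)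
      + 25745 / 151632 * (1 / (n : ℝ)) ^ 2 * fresnelFactor C n ^ 4
      + 250903475 / 3897548928 * (1 / (n : ℝ)) ^ 3 * fresnelFactor C n ^ 8
      + 124092693449 / 3379862723328 * (1 / (n : ℝ)) ^ 4 * fresnelFactor C n ^ 12)
      =O[atTop] fun n : ℕ => (Real.log n / (n : ℝ)) ^ 5 := by
  obtain ⟨a, ha⟩ : ∃ a, a = fun n : ℕ => -(1 / 4) * (55 / 108 * Real.log n - C) / Real.log n :=
    ⟨_, rfl⟩
  obtain ⟨b, hb⟩ : ∃ b, b = fun n : ℕ => 1 / Real.log n := ⟨_, rfl⟩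
  have hB := hasExpansion_fresnelFactor C ha hb
  have he := tendsto_log_div_natCast
  have he1 := he.isBigO_one ℝ
  have z := isBigO_one_const (l := (atTop : Filter ℕ)) 0
  have fn {c : ℕ → ℝ} (hc : c =O[atTop] fun _ => (1 : ℝ)) :
      HasExpansion atTop (fun n : ℕ => Real.log n / (n : ℝ)) c c (fun _ => 0) (fun _ => 0)
        (fun _ => 0) (fun _ => 0) :=
    ⟨hc, z, z, z, z, (isBigO_zero _ _).congr_left fun n => by ring⟩
  have hbe := fn (hb ▸ tendsto_inv_log_natCast.isBigO_one ℝ : b =O[atTop] fun _ => (1 : ℝ))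
  have hae := fn (hB.b1.const_mul_left 4)
  have h4 := hB.pow_four he1
  have h8 := h4.mul he1 h4
  -- Each 1/n is b e: a factor b in the coefficients and one shift.
  have t1 := (hbe.mul he1 ((hB.log he).const_mul (4 * (55 / 108)))).shift he1
  have t2 := (hbe.mul he1 (hbe.mul he1 (h4.const_mul (25745 / 151632))) |>.shift he1).shift he1
  have t3 := ((hbe.mul he1 (hbe.mul he1 (hbe.mul he1 (h8.const_mul (250903475 / 3897548928))))
    |>.shift he1).shift he1).shift he1
  have t4 := (((hbe.mul he1 (hbe.mul he1 (hbe.mul he1 (hbe.mul he1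
    ((h8.mul he1 h4).const_mul (124092693449 / 3379862723328)))))
    |>.shift he1).shift he1).shift he1).shift he1
  have key := ((HasExpansion.const 1).add (h4.const_mul (-1))).add
    (h4.mul he1 (((((hae.shift he1).add t1).add t2).add t3).add t4))
  -- Orders 1 to 4 vanish identically in a and b; these identities are what determine P_1, ..., P_4.
  have hO := key.isBigO_pow_five (fun _ => by ring) (fun _ => by ring) (fun _ => by ring)
    (fun _ => by ring) (fun _ => by ring)
  have hB1 := tendsto_fresnelFactor C
  have hinv : (fun n => (fresnelFactor C n ^ 4)⁻¹) =O[atTop] fun _ => (1 : ℝ) :=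
    ((hB1.pow 4).inv₀ (by norm_num)).isBigO_one ℝ
  refine (((isBigO_refl _ _).mul hinv).trans (by simpa using hO)).congr' ?_ EventuallyEq.rfl
  filter_upwards [eventually_log_natCast_pos, eventually_gt_atTop 0,
    hB1.eventually (lt_mem_nhds one_pos)] with n hn hn0 hBn
  have hn0 : (n : ℝ) ≠ 0 := by positivity
  simp only [ha, hb]
  generalize fresnelFactor C n = B at *
  generalize Real.log B = M at *
  generalize Real.log n = L at *
  field_simp
  ring

theorem fresnelAbel_fresnelFactor_isBigO (C : ℝ) :
    (fun n : ℕ => fresnelAbel (1 / (n : ℝ) * fresnelFactor C n ^ 4) - (n - C))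
      =O[atTop] fun n : ℕ => Real.log n ^ 5 / (n : ℝ) ^ 4 := by
  refine ((isBigO_refl (fun n : ℕ => (n : ℝ)) atTop).mul
    (fresnelFactor_residual_isBigO C)).congr' ?_ ?_
  · filter_upwards [eventually_gt_atTop 0,
      (tendsto_fresnelFactor C).eventually (lt_mem_nhds one_pos)] with n hn0 hB
    have hn0 : (0 : ℝ) < n := by positivity
    rw [fresnelAbel_mul_pow_four (by positivity) hB, one_div (n : ℝ), Real.log_inv]
    generalize fresnelFactor C n = B at *
    field_simp
    ring
  · filter_upwards [eventually_gt_atTop 0] with n hn0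
    have hn0 : (n : ℝ) ≠ 0 := by positivity
    field_simp

/-! ### From the Abel function back to x_n -/

theorem natCast_rpow_div_four (n k : ℕ) :
    (n : ℝ) ^ ((k : ℝ) / 4) = ((n : ℝ) ^ (1 / 4 : ℝ)) ^ k := by
  rw [← Real.rpow_natCast, ← Real.rpow_mul n.cast_nonneg]
  ring_nf

theorem natCast_rpow_quarter_pow_four (n : ℕ) : ((n : ℝ) ^ (1 / 4 : ℝ)) ^ 4 = n := by
  rw [← natCast_rpow_div_four]
  norm_num

theorem fresnelFormulaB_eq (C : ℝ) (n : ℕ) : fresnelFormulaB C n =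
    (10 / Real.pi ^ 2) ^ (1 / 4 : ℝ) / (n : ℝ) ^ (1 / 4 : ℝ) * fresnelFactor C n := by
  rw [fresnelFormulaB, Real.div_rpow (by positivity) n.cast_nonneg, fresnelFactor]

theorem rpow_quarter_pow_four {r : ℝ} (hr : 0 ≤ r) : (r ^ (1 / 4 : ℝ)) ^ 4 = r := by
  rw [← Real.rpow_natCast, ← Real.rpow_mul hr]
  norm_num

theorem fresnelVar_fresnelFormulaB (C : ℝ) (n : ℕ) :
    fresnelVar (fresnelFormulaB C n) = 1 / (n : ℝ) * fresnelFactor C n ^ 4 := by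
  have hp := Real.pi_pos
  rw [fresnelVar, fresnelFormulaB_eq, mul_pow, div_pow, natCast_rpow_quarter_pow_four,
    rpow_quarter_pow_four (by positivity)]
  field_simp

theorem abs_sub_mul_cube_le {x y : ℝ} (hx : 0 ≤ x) (hy : 0 ≤ y) :
    |x - y| * y ^ 3 ≤ |x ^ 4 - y ^ 4| := by
  rw [show x ^ 4 - y ^ 4 = (x - y) * (x ^ 3 + x ^ 2 * y + x * y ^ 2 + y ^ 3) by ring, abs_mul,
    abs_of_nonneg (a := x ^ 3 + x ^ 2 * y + x * y ^ 2 + y ^ 3) (by positivity)]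
  gcongr
  have : 0 ≤ x ^ 3 + x ^ 2 * y + x * y ^ 2 := by positivity
  linarith

theorem sqrt_fresnelKappa_pos : 0 < Real.sqrt fresnelKappa := by
  have := Real.pi_pos
  unfold fresnelKappa
  positivity

theorem rpow_quarter_eq_two_mul_sqrt_fresnelKappa :
    (10 / Real.pi ^ 2) ^ (1 / 4 : ℝ) = 2 * Real.sqrt fresnelKappa := by
  have hp := Real.pi_pos
  -- Comparing fourth powers reduces the claim to 10/π² = 16κ².
  refine (pow_left_inj₀ (by positivity) (by positivity) (four_ne_zero)).1 ?_
  rw [rpow_quarter_pow_four (by positivity), mul_pow,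
    show Real.sqrt fresnelKappa ^ 4 = (Real.sqrt fresnelKappa ^ 2) ^ 2 by ring,
    Real.sq_sqrt (by unfold fresnelKappa; positivity), fresnelKappa, div_pow,
    Real.sq_sqrt (by norm_num)]
  ring

theorem fresnelFormulaB_div_sqrt_fresnelKappa (C : ℝ) {n : ℕ} (hn : 0 < n) :
    fresnelFormulaB C n / Real.sqrt fresnelKappa = fresnelExpansion C n := by
  have hk := sqrt_fresnelKappa_pos
  have hr : (0 : ℝ) < (n : ℝ) ^ (1 / 4 : ℝ) := by positivity
  have h5 := natCast_rpow_div_four n 5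
  have h9 := natCast_rpow_div_four n 9
  have h13 := natCast_rpow_div_four n 13
  have h17 := natCast_rpow_div_four n 17
  have hn4 := natCast_rpow_quarter_pow_four n
  push_cast at h5 h9 h13 h17
  rw [fresnelFormulaB_eq, rpow_quarter_eq_two_mul_sqrt_fresnelKappa, fresnelFactor_eq,
    fresnelExpansion, h5, h9, h13, h17]
  simp only [fresnelP]
  generalize Real.log n = L
  generalize (n : ℝ) ^ (1 / 4 : ℝ) = r at *
  rw [← hn4]
  field_simp
  ring

/-- Let w be `fresnelVar` of the formula. The Abel comparison bounds 1/z - 1/w by ln(n)^5/n^4;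
multiplying by zw = O(n^-2) bounds z - w, hence the difference of fourth powers, by ln(n)^5/n^6.
Dividing by the cube of the formula, of order n^(-3/4), gives the exponent 21/4; no lower bound on
x_n beyond positivity is required. -/
theorem fresnelCos_iterate_sub_fresnelFormulaB_isBigO {x : ℕ → ℝ} (hx0 : 0 < x 0)
    (hx : ∀ n : ℕ, x (n + 1) = fresnelCos (x n)) {C : ℝ}
    (hC : (fun n => fresnelAbel (fresnelVar (x n)) - (n - C))
      =O[atTop] fun n : ℕ => 1 / (n : ℝ) ^ 4) :
    (fun n : ℕ => x n - fresnelFormulaB C n)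
        =O[atTop] fun n : ℕ => Real.log n ^ 5 / (n : ℝ) ^ (21 / 4 : ℝ) := by
  have hlog : (fun n : ℕ => 1 / (n : ℝ) ^ 4) =O[atTop]
      fun n : ℕ => Real.log n ^ 5 / (n : ℝ) ^ 4 := by
    refine IsBigO.of_bound 1 ?_
    filter_upwards [(Real.tendsto_log_atTop.comp
      tendsto_natCast_atTop_atTop).eventually_ge_atTop 1] with n hn
    have hn : 1 ≤ Real.log n := hn
    rw [Real.norm_of_nonneg (by positivity), Real.norm_of_nonneg (by positivity), one_mul]
    gcongr
    exact one_le_pow₀ hn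
  have hz := tendsto_fresnelVar_iterate hx0 hx
  have hB := tendsto_fresnelFactor C
  have hwO : (fun n : ℕ => 1 / (n : ℝ) * fresnelFactor C n ^ 4)
      =O[atTop] fun n : ℕ => 1 / (n : ℝ) :=
    isBigO_mul_one (isBigO_one_pow (hB.isBigO_one ℝ) 4)
  have hw : Tendsto (fun n : ℕ => 1 / (n : ℝ) * fresnelFactor C n ^ 4) atTop (nhds 0) :=
    hwO.trans_tendsto tendsto_one_div_atTop_nhds_zero_nat
  have hpos : ∀ᶠ n : ℕ in atTop, (0 : ℝ) < n ∧ 0 < fresnelFactor C n :=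
    ((eventually_gt_atTop 0).mono fun n hn => by positivity).and
      (hB.eventually (lt_mem_nhds one_pos))
  have hinv : (fun n : ℕ => 1 / fresnelVar (x n) - 1 / (1 / (n : ℝ) * fresnelFactor C n ^ 4))
      =O[atTop] fun n : ℕ => Real.log n ^ 5 / (n : ℝ) ^ 4 := by
    refine IsBigO.trans (IsBigO.of_bound 2 ?_)
      ((hC.trans hlog).sub (fresnelAbel_fresnelFactor_isBigO C))
    have h4 : (0 : ℝ) < 1 / 4 := by norm_num
    filter_upwards [hpos, hw.eventually (ge_mem_nhds h4),
      (hz.mono_right nhdsWithin_le_nhds).eventually (ge_mem_nhds h4)] with n ⟨hn, hBn⟩ hwn hzn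
    rw [sub_sub_sub_cancel_right]
    exact half_mul_abs_sub_le_fresnelAbel
      (fresnelVar_pos (fresnelCos_iterate_pos hx0 hx n)) (by positivity) hzn hwn
  have hr : (fun n : ℕ => ((n : ℝ) ^ (1 / 4 : ℝ)) ^ 3 * (fresnelFactor C n ^ 3)⁻¹) =O[atTop]
      fun n : ℕ => ((n : ℝ) ^ (1 / 4 : ℝ)) ^ 3 :=
    isBigO_mul_one (((hB.pow 3).inv₀ (by norm_num)).isBigO_one ℝ)
  have hprod := (((fresnelVar_iterate_isBigO hx0 hx).mul hwO).mul hinv).mul hr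
  have hp := Real.pi_pos
  set q : ℝ := (10 / Real.pi ^ 2) ^ (1 / 4 : ℝ) with hq
  have hq0 : 0 < q := by positivity
  refine (IsBigO.of_bound (10 / Real.pi ^ 2 / q ^ 3) ?_).trans
    (hprod.congr' EventuallyEq.rfl ?_)
  · filter_upwards [hpos] with n ⟨hn, hBn⟩
    have hxn := fresnelCos_iterate_pos hx0 hx n
    have hzn := fresnelVar_pos hxn
    have hr0 : 0 < (n : ℝ) ^ (1 / 4 : ℝ) := by positivity
    have hF : 0 < fresnelFormulaB C n := by rw [fresnelFormulaB_eq]; positivity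
    have hwn := fresnelVar_pos hF
    have h := abs_sub_mul_cube_le hxn.le hF.le
    rw [← fresnelVar_fresnelFormulaB]
    have e1 : x n ^ 4 - fresnelFormulaB C n ^ 4 = -(10 / Real.pi ^ 2 *
        (fresnelVar (x n) * fresnelVar (fresnelFormulaB C n) *
        (1 / fresnelVar (x n) - 1 / fresnelVar (fresnelFormulaB C n)))) := by
      field_simp
      unfold fresnelVar
      field_simp
      ring
    have e2 : ((n : ℝ) ^ (1 / 4 : ℝ)) ^ 3 * (fresnelFactor C n ^ 3)⁻¹
        = q ^ 3 / fresnelFormulaB C n ^ 3 := by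
      rw [fresnelFormulaB_eq, ← hq]
      field_simp
    rw [e1, abs_neg, abs_mul, abs_of_pos (a := 10 / Real.pi ^ 2) (by positivity),
      ← le_div_iff₀ (by positivity)] at h
    rw [e2, norm_mul, Real.norm_eq_abs, Real.norm_eq_abs,
      Real.norm_of_nonneg (r := q ^ 3 / _) (by positivity)]
    refine h.trans (le_of_eq ?_)
    field_simp
  · filter_upwards [eventually_gt_atTop 0] with n hn
    have hr0 : 0 < (n : ℝ) ^ (1 / 4 : ℝ) := by positivity
    have h21 := natCast_rpow_div_four n 21
    have hn4 := natCast_rpow_quarter_pow_four n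
    push_cast at h21
    rw [h21]
    generalize (n : ℝ) ^ (1 / 4 : ℝ) = r at *
    generalize Real.log n = L
    rw [← hn4]
    field_simp

theorem mainTheorem9 (x : ℕ → ℝ) (hx0 : 0 < x 0)
    (hx : ∀ n : ℕ, x (n + 1) = fresnelCos (x n)) :
    ∃ C : ℝ,
      ((fun n : ℕ => x n - fresnelFormulaB C n)
        =O[atTop] fun n : ℕ => Real.log n ^ 5 / (n : ℝ) ^ (21 / 4 : ℝ)) ∧
      ((fun n : ℕ => x n / Real.sqrt fresnelKappa - fresnelExpansion C n)
        =O[atTop] fun n : ℕ => Real.log n ^ 5 / (n : ℝ) ^ (21 / 4 : ℝ)) := by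
  obtain ⟨C, hC⟩ := exists_fresnelAbel_iterate_isBigO hx0 hx
  have h := fresnelCos_iterate_sub_fresnelFormulaB_isBigO hx0 hx hC
  refine ⟨C, h, (h.const_mul_left (1 / Real.sqrt fresnelKappa)).congr' ?_ EventuallyEq.rfl⟩
  filter_upwards [eventually_gt_atTop 0] with n hn
  rw [← fresnelFormulaB_div_sqrt_fresnelKappa C hn]
  ring
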